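/- All partitions are integer partitions (the empty partition of $0$ is allowed). For a partition $\pi$ let $|\pi|$ be the sum of its parts, $l(\pi)$ its largest part (with $l(\emptyset)=0$), $\#(\pi)$ its number of parts counted with multiplicity, and $\mathrm{rank}(\pi)=l(\pi)-\#(\pi)$; its Durfee square has size $j$ if $j$ is the largest integer such that $\pi$ has at least $j$ parts that are $\ge j$. For integers $N\ge 1$, $n\ge 0$ and $m\in\mathbb{Z}$ put: - $p(n,N)$: the number of partitions of $n$ with largest part at most $N$; - $\mathrm{spt}(n,N)$: the total number of appearances of the smallest part in all partitions of $n$ with largest part at most $N$ (so $\mathrm{spt}(0,N)=0$); - $\sigma(k,N)=\sum_{d\mid k,\ d\ge k/N} d$ for $k\ge1$; - $N_{S_1}(m,n)=\sum_{j=1}^{N}\ \sum_{(\pi_1,\pi_2)}(-1)^{\#(\pi_1)}$, the inner sum running over all pairs of partitions with $|\pi_1|+|\pi_2|=n$ such that $\pi_1$ has distinct parts, all lying in $[N-j+1,N]$ ($\pi_1$ may be empty), and $\pi_2$ has Durfee square of size $j$ and $\mathrm{rank}(\pi_2)=m$; - $M_{S_2}(m,n)=\sum_{(\pi_1,\pi_2,\pi_3)}(-1)^{\#(\pi_1)}$,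 the sum running over all triples of partitions with $|\pi_1|+|\pi_2|+|\pi_3|=n$ such that $\pi_1$ has distinct parts, $l(\pi_1),l(\pi_2),l(\pi_3)\le N$ and $\#(\pi_2)-\#(\pi_3)=m$; - the finite second rank and crank moments $$N_{2,N}(n)=\sum_{m=-\infty}^{\infty}m^2N_{S_1}(m,n),\qquad M_{2,N}(n)=\sum_{m=-\infty}^{\infty}m^2M_{S_2}(m,n),$$ in which only finitely many terms are nonzero. **Theorem.** For all integers $N\ge1$ and $n\ge0$, $$\mathrm{spt}(n,N)=\tfrac12\bigl(M_{2,N}(n)-N_{2,N}(n)\bigr),$$ and also $$\mathrm{spt}(n,N)=\sum_{j=0}^{n-1}p(j,N)\,\sigma(n-j,N)-\tfrac12N_{2,N}(n).$$ -/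

import Mathlib

namespace FiniteSpt

/-- The largest part of a partition (`0` for the empty partition). -/
def largestPart {n : ℕ} (π : n.Partition) : ℕ := π.parts.sup

/-- The number of parts of a partition, counted with multiplicity. -/
def numParts {n : ℕ} (π : n.Partition) : ℕ := Multiset.card π.parts

/-- The rank of a partition: the largest part minus the number of parts. -/
def rank {n : ℕ} (π : n.Partition) : ℤ := (largestPart π : ℤ) - (numParts π : ℤ)

/-- The size of the Durfee square: the largest `k` such that at least `k` parts
are greater than or equal to `k` (such a `k` is at most `n`). -/
def durfeeSize {n : ℕ} (π : n.Partition) : ℕ :=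
  Nat.findGreatest (fun k => k ≤ Multiset.card (π.parts.filter (fun i => k ≤ i))) n

/-- The number of appearances of the smallest part in a partition
(`0` for the empty partition). -/
def numSmallest {n : ℕ} (π : n.Partition) : ℕ :=
  Multiset.card (π.parts.filter (fun i => ∀ j ∈ π.parts, i ≤ j))

/-- `𝒫(n, N)`: the partitions of `n` whose largest part is at most `N`. -/
def partitionsLE (n N : ℕ) : Finset n.Partition :=
  Finset.univ.filter (fun π => largestPart π ≤ N)

/-- `p(n, N)`: the number of partitions of `n` whose largest part is at most `N`. -/
def p (n N : ℕ) : ℕ := (partitionsLE n N).card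

/-- `spt(n, N)`: the number of smallest parts in all partitions of `n` whose largest part
is at most `N`. -/
def spt (n N : ℕ) : ℕ := ∑ π ∈ partitionsLE n N, numSmallest π

/-- `σ(k, N)`: the sum of the divisors `d` of `k` with `d ≥ k / N` (for `N ≥ 1`). -/
def sigma (k N : ℕ) : ℕ := ∑ d ∈ k.divisors with k ≤ d * N, d

/-- The sum, weighted by `(-1) ^ #π₁`, over the pairs `(π₁, π₂)` with `|π₁| + |π₂| = n` such that
`π₁` has distinct parts, all of them in `[N - j + 1, N]` (`π₁` may be empty), and `π₂` is a
partition of rank `m` with Durfee square of size `j`. -/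
def rankCountDurfee (N : ℕ) (m : ℤ) (n j : ℕ) : ℤ :=
  ∑ a ∈ Finset.HasAntidiagonal.antidiagonal n,
    ∑ π₁ ∈ Nat.Partition.distincts a.1 with ∀ i ∈ π₁.parts, N + 1 ≤ i + j ∧ i ≤ N,
      ∑ π₂ : a.2.Partition with durfeeSize π₂ = j ∧ rank π₂ = m,
        (-1) ^ numParts π₁

/-- The finite rank counting function: the sum over `1 ≤ j ≤ N` of the weighted counts with
Durfee square of size `j`. -/
def rankCount (N : ℕ) (m : ℤ) (n : ℕ) : ℤ :=
  ∑ j ∈ Finset.Icc 1 N, rankCountDurfee N m n j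

/-- The finite crank counting function: the sum, weighted by `(-1) ^ #π₁`, over the triples
`(π₁, π₂, π₃)` with `|π₁| + |π₂| + |π₃| = n` and all parts at most `N`, such that `π₁` has
distinct parts and the crank `#π₂ - #π₃` equals `m`. -/
def crankCount (N : ℕ) (m : ℤ) (n : ℕ) : ℤ :=
  ∑ a ∈ Finset.HasAntidiagonal.antidiagonal n, ∑ b ∈ Finset.HasAntidiagonal.antidiagonal a.2,
    ∑ π₁ ∈ Nat.Partition.distincts a.1 with largestPart π₁ ≤ N,
      ∑ π₂ ∈ partitionsLE b.1 N,
        ∑ π₃ ∈ partitionsLE b.2 N with (numParts π₂ : ℤ) - (numParts π₃ : ℤ) = m,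
          (-1) ^ numParts π₁

/-- The `k`-th finite rank moment `N_{k,N}(n)`, a sum over all integers `m` with only finitely many
nonzero terms (see `rankCount_eq_zero`). -/
noncomputable def rankMoment (k N n : ℕ) : ℤ := ∑ᶠ m : ℤ, m ^ k * rankCount N m n

/-- The `k`-th finite crank moment `M_{k,N}(n)`, a sum over all integers `m` with only finitely many
nonzero terms (see `crankCount_eq_zero`). -/
noncomputable def crankMoment (k N n : ℕ) : ℤ := ∑ᶠ m : ℤ, m ^ k * crankCount N m n

theorem largestPart_le {n : ℕ} (π : n.Partition) : largestPart π ≤ n :=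
  Multiset.sup_le.2 fun _ hi => Nat.Partition.le_of_mem_parts hi

theorem numParts_le {n : ℕ} (π : n.Partition) : numParts π ≤ n := by
  have h := Multiset.card_nsmul_le_sum (s := π.parts) (a := 1) fun x hx => π.parts_pos hx
  simpa [numParts, π.parts_sum] using h

/-- Ranks of partitions of size at most `n` lie in `[-n, n]`. -/
theorem rankCount_eq_zero (N n : ℕ) (m : ℤ) (hm : (n : ℤ) < |m|) : rankCount N m n = 0 := by
  refine Finset.sum_eq_zero fun j _ => Finset.sum_eq_zero fun a ha =>
    Finset.sum_eq_zero fun π₁ _ => Finset.sum_eq_zero fun π₂ h₂ => ?_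
  have h := (Finset.mem_filter.1 h₂).2.2
  have ha' := Finset.HasAntidiagonal.mem_antidiagonal.1 ha
  have h1 := largestPart_le π₂
  have h2 := numParts_le π₂
  unfold rank at h
  rcases lt_abs.1 hm with h3 | h3 <;> omega

/-- Cranks of vector partitions of `n` lie in `[-n, n]`. -/
theorem crankCount_eq_zero (N n : ℕ) (m : ℤ) (hm : (n : ℤ) < |m|) : crankCount N m n = 0 := by
  refine Finset.sum_eq_zero fun a ha => Finset.sum_eq_zero fun b hb =>
    Finset.sum_eq_zero fun π₁ _ => Finset.sum_eq_zero fun π₂ _ =>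
    Finset.sum_eq_zero fun π₃ h₃ => ?_
  have h := (Finset.mem_filter.1 h₃).2
  have ha' := Finset.HasAntidiagonal.mem_antidiagonal.1 ha
  have hb' := Finset.HasAntidiagonal.mem_antidiagonal.1 hb
  have h1 := numParts_le π₂
  have h2 := numParts_le π₃
  rcases lt_abs.1 hm with h3 | h3 <;> omega

end FiniteSpt

/-! Write (q)_N = ∏_{i≤N} (1 - q^i) and L_N = Σ_{i≤N} q^i/(1 - q^i)^2. Every generating function in
the theorem is expressed through these.

Crank. Weight partitions with parts at most N by q^{|π|}. The multiplicities of the parts are then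
independent geometric variables, and L_N is the variance of the number of parts. Hence for a pair of
such partitions the second moment of the difference of the numbers of parts is 2 L_N/(q)_N^2
(`moments_eq`). The signed distinct parts contribute (q)_N, so the crank moments have series 2
L_N/(q)_N. Since L_N also generates σ(·, N), this is twice the convolution of p and σ, and the two
formulas of the theorem agree (`crankSeries_eq`).

Rank. Removing a Durfee square of size j leaves a partition a with parts at most j and a partition b
into at most j parts, and the rank is l(b) - #(a). The largest part of b is distributed like a
number of parts (`gf_card_le_sup`), so the second moment is again a variance and gives q^{j^2} · 2
L_j/(q)_j^2 (`gf_isDurfee_rank_sq`). With the factor (q)_N/(q)_{N-j} from π₁, the rank series is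
(2/(q)_N) Σ_j w(N,j) L_j, where w is `durfeeWeight`.

What remains is (q)_N S_N = L_N - Σ_j w(N,j) L_j for the spt series S_N (`poch_mul_eq_lambert_sub`).
Both sides vanish at N = 0 and have equal increments in N. On the left this comes from splitting off
a largest part (`sptSeries_succ`), on the right from a Wilf–Zeilberger pair and summation by parts
(`sum_durfeeWeight_lambert_succ`). -/

open PowerSeries

namespace FiniteSpt

/-! ### Generating functions of multisets of parts -/

/-- The multisets of positive integers with sum `n`. -/
def partsFinset (n : ℕ) : Finset (Multiset ℕ) :=
  (Finset.univ : Finset n.Partition).image Nat.Partition.parts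

theorem mem_partsFinset {n : ℕ} {s : Multiset ℕ} :
    s ∈ partsFinset n ↔ s.sum = n ∧ 0 ∉ s := by
  simp only [partsFinset, Finset.mem_image, Finset.mem_univ, true_and]
  constructor
  · rintro ⟨π, rfl⟩
    exact ⟨π.parts_sum, fun h => (π.parts_pos h).ne rfl⟩
  · rintro ⟨h, h0⟩
    exact ⟨⟨s, fun {i} hi => Nat.pos_of_ne_zero fun h => h0 (h ▸ hi), h⟩, rfl⟩

open Classical in
/-- The generating function, by the sum of the parts, of the multisets of positive integers
satisfying `P`, each with weight `W`. -/
noncomputable def gf (P : Multiset ℕ → Prop) (W : Multiset ℕ → ℤ) : ℤ⟦X⟧ :=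
  PowerSeries.mk fun n => ∑ s ∈ partsFinset n with P s, W s

open Classical in
theorem coeff_gf (P : Multiset ℕ → Prop) (W : Multiset ℕ → ℤ) (n : ℕ) :
    coeff n (gf P W) = ∑ s ∈ partsFinset n with P s, W s := by
  simp [gf]

attribute [irreducible] gf

theorem sum_partition {n : ℕ} (P : Multiset ℕ → Prop) (W : Multiset ℕ → ℤ)
    (S : Finset n.Partition) (hS : ∀ π, π ∈ S ↔ P π.parts) :
    ∑ π ∈ S, W π.parts = coeff n (gf P W) := by
  classical
  rw [coeff_gf, partsFinset, Finset.filter_image, Finset.sum_image]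
  · refine Finset.sum_congr ?_ fun _ _ => rfl
    ext π
    simp [hS]
  · intro a _ b _ h
    exact Nat.Partition.ext h

theorem gf_congr {P Q : Multiset ℕ → Prop} {V W : Multiset ℕ → ℤ}
    (hP : ∀ s, 0 ∉ s → (P s ↔ Q s)) (hW : ∀ s, 0 ∉ s → Q s → V s = W s) : gf P V = gf Q W := by
  classical
  ext n
  rw [coeff_gf, coeff_gf]
  refine Finset.sum_congr ?_ ?_
  · ext s
    simp only [Finset.mem_filter]
    exact and_congr_right fun h => hP s (mem_partsFinset.1 h).2
  · intro s hs
    rw [Finset.mem_filter] at hs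
    exact hW s (mem_partsFinset.1 hs.1).2 hs.2

theorem gf_add (P : Multiset ℕ → Prop) (V W : Multiset ℕ → ℤ) :
    gf P (fun s => V s + W s) = gf P V + gf P W := by
  classical
  ext n
  simp [coeff_gf, Finset.sum_add_distrib]

theorem gf_neg (P : Multiset ℕ → Prop) (W : Multiset ℕ → ℤ) :
    gf P (fun s => -W s) = -gf P W := by
  classical
  ext n
  simp [coeff_gf]

theorem gf_ite (P Q : Multiset ℕ → Prop) [DecidablePred Q] (W : Multiset ℕ → ℤ) :
    gf P (fun s => if Q s then W s else 0) = gf (fun s => P s ∧ Q s) W := by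
  classical
  ext n
  rw [coeff_gf, coeff_gf, ← Finset.sum_filter, Finset.filter_filter]
  refine Finset.sum_congr ?_ fun _ _ => rfl
  ext s
  simp

theorem gf_split (P Q : Multiset ℕ → Prop) (W : Multiset ℕ → ℤ) :
    gf P W = gf (fun s => P s ∧ Q s) W + gf (fun s => P s ∧ ¬ Q s) W := by
  classical
  ext n
  rw [map_add, coeff_gf, coeff_gf, coeff_gf,
    ← Finset.sum_filter_add_sum_filter_not ((partsFinset n).filter P) Q]
  congr 1 <;> refine Finset.sum_congr ?_ fun _ _ => rfl <;> ext s <;> simp [and_assoc]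

theorem gf_empty (P : Multiset ℕ → Prop) (W : Multiset ℕ → ℤ) (hP : ∀ s, 0 ∉ s → (P s ↔ s = 0)) :
    gf P W = C (W 0) := by
  classical
  ext n
  rw [coeff_gf, coeff_C]
  split_ifs with hn
  · subst hn
    rw [Finset.sum_eq_single 0]
    · intro s hs h0
      rw [Finset.mem_filter] at hs
      exact absurd ((hP s (mem_partsFinset.1 hs.1).2).1 hs.2) h0
    · intro h
      refine absurd ?_ h
      rw [Finset.mem_filter]
      exact ⟨mem_partsFinset.2 ⟨rfl, by simp⟩, (hP 0 (by simp)).2 rfl⟩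
  · refine Finset.sum_eq_zero fun s hs => absurd ?_ hn
    rw [Finset.mem_filter, mem_partsFinset] at hs
    rw [← hs.1.1, (hP s hs.1.2).1 hs.2, Multiset.sum_zero]

/-- A weight-preserving bijection that raises the sum by `k` multiplies the generating function
by `X ^ k`. -/
theorem gf_eq_X_pow_mul (k : ℕ) (P Q : Multiset ℕ → Prop) (W : Multiset ℕ → ℤ)
    (f g : Multiset ℕ → Multiset ℕ)
    (hf : ∀ t, 0 ∉ t → Q t → 0 ∉ f t ∧ P (f t) ∧ (f t).sum = t.sum + k ∧ g (f t) = t)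
    (hg : ∀ s, 0 ∉ s → P s → 0 ∉ g s ∧ Q (g s) ∧ f (g s) = s) :
    gf P W = X ^ k * gf Q (fun t => W (f t)) := by
  classical
  ext n
  rw [coeff_X_pow_mul', coeff_gf]
  -- The effect of `g` on sums follows from that of `f`, applied to `g s`.
  have key : ∀ s ∈ (partsFinset n).filter P, (g s).sum + k = n := by
    intro s hs
    rw [Finset.mem_filter, mem_partsFinset] at hs
    obtain ⟨h1, h2, h3⟩ := hg s hs.1.2 hs.2
    rw [← (hf _ h1 h2).2.2.1, h3, hs.1.1]
  split_ifs with hk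
  · rw [coeff_gf]
    refine Finset.sum_bij' (fun s _ => g s) (fun t _ => f t) ?_ ?_ ?_ ?_ ?_
    · intro s hs
      have hsum := key s hs
      rw [Finset.mem_filter, mem_partsFinset] at hs ⊢
      obtain ⟨h1, h2, h3⟩ := hg s hs.1.2 hs.2
      exact ⟨⟨by omega, h1⟩, h2⟩
    · intro t ht
      rw [Finset.mem_filter, mem_partsFinset] at ht ⊢
      obtain ⟨h1, h2, h3, -⟩ := hf t ht.1.2 ht.2
      exact ⟨⟨by omega, h1⟩, h2⟩
    · intro s hs
      rw [Finset.mem_filter, mem_partsFinset] at hs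
      exact (hg s hs.1.2 hs.2).2.2
    · intro t ht
      rw [Finset.mem_filter, mem_partsFinset] at ht
      exact (hf t ht.1.2 ht.2).2.2.2
    · intro s hs
      rw [Finset.mem_filter, mem_partsFinset] at hs
      simp only [(hg s hs.1.2 hs.2).2.2]
  · refine Finset.sum_eq_zero fun s hs => absurd (key s hs) ?_
    omega

open Classical in
/-- The generating function of pairs of multisets of positive integers. -/
noncomputable def gfPair (P Q : Multiset ℕ → Prop) (W : Multiset ℕ → Multiset ℕ → ℤ) : ℤ⟦X⟧ :=
  PowerSeries.mk fun n => ∑ a ∈ Finset.HasAntidiagonal.antidiagonal n,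
    ∑ s ∈ partsFinset a.1 with P s, ∑ t ∈ partsFinset a.2 with Q t, W s t

open Classical in
theorem coeff_gfPair (P Q : Multiset ℕ → Prop) (W : Multiset ℕ → Multiset ℕ → ℤ) (n : ℕ) :
    coeff n (gfPair P Q W) = ∑ a ∈ Finset.HasAntidiagonal.antidiagonal n,
      ∑ s ∈ partsFinset a.1 with P s, ∑ t ∈ partsFinset a.2 with Q t, W s t := by
  simp [gfPair]

attribute [irreducible] gfPair

theorem gfPair_congr {P Q : Multiset ℕ → Prop} {V W : Multiset ℕ → Multiset ℕ → ℤ}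
    (h : ∀ s t, P s → Q t → V s t = W s t) : gfPair P Q V = gfPair P Q W := by
  classical
  ext n
  rw [coeff_gfPair, coeff_gfPair]
  exact Finset.sum_congr rfl fun x _ => Finset.sum_congr rfl fun s hs =>
    Finset.sum_congr rfl fun t ht => h s t (Finset.mem_filter.1 hs).2 (Finset.mem_filter.1 ht).2

theorem gfPair_mul (P Q : Multiset ℕ → Prop) (V W : Multiset ℕ → ℤ) :
    gfPair P Q (fun s t => V s * W t) = gf P V * gf Q W := by
  classical
  ext n
  rw [coeff_gfPair, coeff_mul]
  refine Finset.sum_congr rfl fun a _ => ?_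
  rw [coeff_gf, coeff_gf, Finset.sum_mul_sum]

theorem gfPair_sub_sq (P Q : Multiset ℕ → Prop) (V W : Multiset ℕ → ℤ) :
    gfPair P Q (fun s t => (V s - W t) ^ 2) =
      gf P (fun s => V s ^ 2) * gf Q (fun _ => 1) - 2 * (gf P V * gf Q W) +
        gf P (fun _ => 1) * gf Q (fun t => W t ^ 2) := by
  classical
  rw [← gfPair_mul, ← gfPair_mul, ← gfPair_mul, two_mul]
  ext n
  simp only [map_add, map_sub, coeff_gfPair, ← Finset.sum_add_distrib, ← Finset.sum_sub_distrib]
  refine Finset.sum_congr rfl fun a _ => Finset.sum_congr rfl fun s _ =>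
    Finset.sum_congr rfl fun t _ => ?_
  ring

/-- The analogue of `gf_eq_X_pow_mul` for a decomposition into two multisets. -/
theorem gf_eq_X_pow_mul_gfPair (k : ℕ) (P Q R : Multiset ℕ → Prop) (W : Multiset ℕ → ℤ)
    (f : Multiset ℕ → Multiset ℕ → Multiset ℕ) (g h : Multiset ℕ → Multiset ℕ)
    (hf : ∀ a b, 0 ∉ a → 0 ∉ b → Q a → R b → 0 ∉ f a b ∧ P (f a b) ∧
      (f a b).sum = a.sum + b.sum + k ∧ g (f a b) = a ∧ h (f a b) = b)
    (hg : ∀ s, 0 ∉ s → P s → 0 ∉ g s ∧ 0 ∉ h s ∧ Q (g s) ∧ R (h s) ∧ f (g s) (h s) = s) :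
    gf P W = X ^ k * gfPair Q R (fun a b => W (f a b)) := by
  classical
  ext n
  rw [coeff_X_pow_mul', coeff_gf]
  have key : ∀ s ∈ (partsFinset n).filter P, (g s).sum + (h s).sum + k = n := by
    intro s hs
    rw [Finset.mem_filter, mem_partsFinset] at hs
    obtain ⟨h1, h2, h3, h4, h5⟩ := hg s hs.1.2 hs.2
    rw [← (hf _ _ h1 h2 h3 h4).2.2.1, h5, hs.1.1]
  split_ifs with hk
  · rw [coeff_gfPair]
    simp only [← Finset.sum_product']
    rw [Finset.sum_sigma']
    refine Finset.sum_bij' (fun s _ => ⟨((g s).sum, (h s).sum), (g s, h s)⟩)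
      (fun x _ => f x.2.1 x.2.2) ?_ ?_ ?_ ?_ ?_
    · intro s hs
      have hsum := key s hs
      rw [Finset.mem_filter, mem_partsFinset] at hs
      obtain ⟨h1, h2, h3, h4, h5⟩ := hg s hs.1.2 hs.2
      simp only [Finset.mem_sigma, Finset.mem_product, Finset.mem_filter, mem_partsFinset,
        Finset.HasAntidiagonal.mem_antidiagonal]
      exact ⟨by omega, ⟨⟨trivial, h1⟩, h3⟩, ⟨trivial, h2⟩, h4⟩
    · rintro ⟨⟨i, j⟩, ⟨a, b⟩⟩ hx
      simp only [Finset.mem_sigma, Finset.mem_product, Finset.mem_filter, mem_partsFinset,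
        Finset.HasAntidiagonal.mem_antidiagonal] at hx ⊢
      obtain ⟨hij, ⟨⟨ha, ha0⟩, hQ⟩, ⟨hb, hb0⟩, hR⟩ := hx
      obtain ⟨h1, h2, h3, -⟩ := hf a b ha0 hb0 hQ hR
      exact ⟨⟨by omega, h1⟩, h2⟩
    · intro s hs
      rw [Finset.mem_filter, mem_partsFinset] at hs
      exact (hg s hs.1.2 hs.2).2.2.2.2
    · rintro ⟨⟨i, j⟩, ⟨a, b⟩⟩ hx
      simp only [Finset.mem_sigma, Finset.mem_product, Finset.mem_filter, mem_partsFinset,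
        Finset.HasAntidiagonal.mem_antidiagonal] at hx ⊢
      obtain ⟨hij, ⟨⟨ha, ha0⟩, hQ⟩, ⟨hb, hb0⟩, hR⟩ := hx
      obtain ⟨h1, h2, h3, h4, h5⟩ := hf a b ha0 hb0 hQ hR
      rw [h4, h5, ha, hb]
    · intro s hs
      rw [Finset.mem_filter, mem_partsFinset] at hs
      simp only [(hg s hs.1.2 hs.2).2.2.2.2]
  · refine Finset.sum_eq_zero fun s hs => absurd (key s hs) ?_
    omega

/-! ### Splitting off a part or a column, and the conjugation symmetry -/

/-- Splitting off one copy of the largest admissible part. -/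
theorem gf_le_and_succ (N : ℕ) (Q : Multiset ℕ → Prop) (W : Multiset ℕ → ℤ) :
    gf (fun s => (∀ i ∈ s, i ≤ N + 1) ∧ Q s) W = gf (fun s => (∀ i ∈ s, i ≤ N) ∧ Q s) W +
      X ^ (N + 1) * gf (fun s => (∀ i ∈ s, i ≤ N + 1) ∧ Q ((N + 1) ::ₘ s))
        (fun s => W ((N + 1) ::ₘ s)) := by
  rw [gf_split _ (fun s => N + 1 ∉ s)]
  congr 1
  · refine gf_congr (fun s _ => ⟨fun h => ⟨fun i hi => ?_, h.1.2⟩,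
      fun h => ⟨⟨fun i hi => ?_, h.2⟩, fun hN => ?_⟩⟩) fun _ _ _ => rfl
    · have := h.1.1 i hi
      have : i ≠ N + 1 := fun hh => h.2 (hh ▸ hi)
      omega
    · have := h.1 i hi
      omega
    · have := h.1 _ hN
      omega
  · refine gf_eq_X_pow_mul (N + 1) _ _ W (fun t => (N + 1) ::ₘ t) (fun s => s.erase (N + 1)) ?_ ?_
    · rintro t h0 ⟨ht, hQ⟩
      refine ⟨by simp [h0], ⟨⟨?_, hQ⟩, by simp⟩, by simp [add_comm], by simp⟩
      simpa using ht
    · rintro s h0 ⟨⟨hs, hQ⟩, hN⟩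
      have h1 := Multiset.cons_erase (not_not.1 hN)
      exact ⟨fun h => h0 (Multiset.mem_of_mem_erase h),
        ⟨fun i hi => hs i (Multiset.mem_of_mem_erase hi), h1.symm ▸ hQ⟩, h1⟩

theorem gf_le_succ (N : ℕ) (W : Multiset ℕ → ℤ) :
    gf (fun s => ∀ i ∈ s, i ≤ N + 1) W = gf (fun s => ∀ i ∈ s, i ≤ N) W +
      X ^ (N + 1) * gf (fun s => ∀ i ∈ s, i ≤ N + 1) (fun s => W ((N + 1) ::ₘ s)) := by
  simpa only [and_true] using gf_le_and_succ N (fun _ => True) W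

/-- Splitting off one column from the multisets with the largest admissible number of parts. -/
theorem gf_card_le_succ (j : ℕ) (W : Multiset ℕ → ℤ) :
    gf (fun s => s.card ≤ j + 1) W = gf (fun s => s.card ≤ j) W +
      X ^ (j + 1) * gf (fun s => s.card ≤ j + 1)
        (fun s => W (s.map (· + 1) + Multiset.replicate (j + 1 - s.card) 1)) := by
  rw [gf_split _ (fun s => s.card ≤ j)]
  congr 1
  · exact gf_congr (fun s _ => ⟨fun h => h.2, fun h => ⟨h.trans (Nat.le_succ j), h⟩⟩)
      fun _ _ _ => rfl
  -- With exactly `j + 1` parts, the first column has height `j + 1`. Restoring it raises every part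
  -- by one and pads with ones.
  · refine gf_eq_X_pow_mul (j + 1) _ _ W
      (fun s => s.map (· + 1) + Multiset.replicate (j + 1 - s.card) 1)
      (fun s => (s.filter (1 < ·)).map (· - 1)) ?_ ?_
    · intro t h0 ht
      refine ⟨?_, ⟨?_, ?_⟩, ?_, ?_⟩
      · simp [Multiset.mem_replicate]
      · simp; omega
      · simp; omega
      · simp [Multiset.sum_map_add]; omega
      · have h1 : (t.map (· + 1)).filter (1 < ·) = t.map (· + 1) := by
          rw [Multiset.filter_eq_self]
          intro a ha
          obtain ⟨b, hb, rfl⟩ := Multiset.mem_map.1 ha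
          have : b ≠ 0 := fun h => h0 (h ▸ hb)
          omega
        have h2 : (Multiset.replicate (j + 1 - t.card) 1).filter (1 < ·) = 0 := by
          rw [Multiset.filter_eq_nil]
          intro a ha
          rw [Multiset.eq_of_mem_replicate ha]
          omega
        simp only [Multiset.filter_add, h1, h2, add_zero, Multiset.map_map]
        simp
    · rintro s h0 ⟨hs, hj⟩
      refine ⟨?_, ?_, ?_⟩
      · simp only [Multiset.mem_map, Multiset.mem_filter, not_exists, not_and]
        intro a ha
        omega
      · simp only [Multiset.card_map]
        exact (Multiset.card_le_card (Multiset.filter_le _ _)).trans hs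
      · have h1 : ((s.filter (1 < ·)).map (· - 1)).map (· + 1) = s.filter (1 < ·) := by
          rw [Multiset.map_map]
          conv_rhs => rw [← Multiset.map_id (s.filter (1 < ·))]
          refine Multiset.map_congr rfl fun a ha => ?_
          have := (Multiset.mem_filter.1 ha).2
          simp only [Function.comp, id]
          omega
        have h2 : s.filter (fun i => ¬ 1 < i) =
            Multiset.replicate (s.filter (fun i => ¬ 1 < i)).card 1 := by
          rw [Multiset.eq_replicate]
          refine ⟨rfl, fun a ha => ?_⟩
          have h3 := Multiset.mem_filter.1 ha
          have : a ≠ 0 := fun h => h0 (h ▸ h3.1)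
          omega
        have h3 := congrArg Multiset.card (Multiset.filter_add_not (1 < ·) s)
        rw [Multiset.card_add] at h3
        simp only [h1, Multiset.card_map]
        have h4 : j + 1 - (s.filter (1 < ·)).card = (s.filter (fun i => ¬ 1 < i)).card := by omega
        rw [h4, ← h2, Multiset.filter_add_not]

theorem gf_le_zero (W : Multiset ℕ → ℤ) : gf (fun s => ∀ i ∈ s, i ≤ 0) W = C (W 0) := by
  refine gf_empty _ W fun s h0 => ⟨fun h => ?_, fun h => by simp [h]⟩
  refine Multiset.eq_zero_of_forall_notMem fun i hi => h0 ?_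
  rwa [← Nat.le_zero.1 (h i hi)]

theorem gf_card_le_zero (W : Multiset ℕ → ℤ) : gf (fun s => s.card ≤ 0) W = C (W 0) :=
  gf_empty _ W fun s _ => by simp

/-- Serves both reassemblies: restoring a column (`a = 0`, `k = 1`) and restoring a Durfee square
(`k = j`). As `0 < j`, either `b` has a part or the padding is nonempty, so the value `k` is reached
even for empty `b`. -/
theorem sup_map_add (a b : Multiset ℕ) (j k : ℕ) (hj : 0 < j) (hb : b.card ≤ j)
    (ha : ∀ i ∈ a, i ≤ k) :
    (b.map (· + k) + Multiset.replicate (j - b.card) k + a).sup = b.sup + k := by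
  apply le_antisymm
  · refine Multiset.sup_le.2 fun i hi => ?_
    rw [Multiset.mem_add, Multiset.mem_add] at hi
    rcases hi with (hi | hi) | hi
    · obtain ⟨x, hx, rfl⟩ := Multiset.mem_map.1 hi
      exact Nat.add_le_add_right (Multiset.le_sup hx) k
    · rw [Multiset.eq_of_mem_replicate hi]
      exact Nat.le_add_left _ _
    · exact (ha i hi).trans (Nat.le_add_left _ _)
  · set M := (b.map (· + k) + Multiset.replicate (j - b.card) k + a).sup with hM
    have h1 : ∀ i ∈ b, i + k ≤ M := fun i hi => Multiset.le_sup (by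
      rw [Multiset.mem_add, Multiset.mem_add]
      exact Or.inl (Or.inl (Multiset.mem_map_of_mem (· + k) hi)))
    have h2 : k ≤ M := by
      rcases Multiset.empty_or_exists_mem b with rfl | ⟨i, hi⟩
      · refine Multiset.le_sup ?_
        rw [Multiset.mem_add, Multiset.mem_add, Multiset.mem_replicate]
        exact Or.inl (Or.inr ⟨by simpa using hj.ne', rfl⟩)
      · exact (Nat.le_add_left _ _).trans (h1 i hi)
    have h3 : b.sup ≤ M - k := Multiset.sup_le.2 fun i hi => by
      have := h1 i hi
      omega
    omega

/-- The largest part over the partitions into at most `N` parts is distributed like the number of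
parts over the partitions with parts at most `N`. -/
theorem gf_card_le_sup (N : ℕ) (f : ℕ → ℤ) :
    gf (fun s => s.card ≤ N) (fun s => f s.sup) =
      gf (fun s => ∀ i ∈ s, i ≤ N) (fun s => f s.card) := by
  induction N generalizing f with
  | zero =>
    rw [gf_le_zero, gf_card_le_zero]
    simp
  | succ N ih =>
    ext n
    -- Both recurrences contain the unknown series again, but behind `X ^ (N + 1)`, so only lower
    -- coefficients enter. There `f` is replaced by its shift, hence the generalization.
    induction n using Nat.strong_induction_on generalizing f with
    | _ n ihn =>
      rw [gf_le_succ N (fun s => f s.card), gf_card_le_succ N (fun s => f s.sup), map_add, map_add,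
        ih f, coeff_X_pow_mul', coeff_X_pow_mul']
      congr 1
      split_ifs with hn
      · have h := ihn (n - (N + 1)) (by omega) (fun c => f (c + 1))
        simp only [Multiset.card_cons]
        rw [← h]
        congr 1
        refine gf_congr (fun _ _ => Iff.rfl) fun s _ hs => ?_
        have h1 := sup_map_add 0 s (N + 1) 1 N.succ_pos hs (by simp)
        rw [add_zero] at h1
        rw [h1]
      · rfl

/-! ### Recurrences in N for the moments, the signed products and spt -/

/-- The `k`-th moment of the number of parts over the partitions with parts at most `N`. -/
noncomputable def cardMoment (k N : ℕ) : ℤ⟦X⟧ :=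
  gf (fun s => ∀ i ∈ s, i ≤ N) (fun s => (s.card : ℤ) ^ k)

theorem cardMoment_zero_zero : cardMoment 0 0 = 1 := by
  rw [cardMoment, gf_le_zero]
  simp

theorem cardMoment_zero {k : ℕ} (hk : k ≠ 0) : cardMoment k 0 = 0 := by
  rw [cardMoment, gf_le_zero]
  simp [hk]

theorem cardMoment_zero_succ (N : ℕ) :
    cardMoment 0 (N + 1) = cardMoment 0 N + X ^ (N + 1) * cardMoment 0 (N + 1) := by
  conv_lhs => rw [cardMoment, gf_le_succ]
  simp [cardMoment]

theorem cardMoment_one_succ (N : ℕ) :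
    cardMoment 1 (N + 1) = cardMoment 1 N +
      X ^ (N + 1) * (cardMoment 1 (N + 1) + cardMoment 0 (N + 1)) := by
  conv_lhs => rw [cardMoment, gf_le_succ]
  simp only [cardMoment, ← gf_add]
  congr 3
  ext s
  push_cast [Multiset.card_cons]
  ring

theorem cardMoment_two_succ (N : ℕ) :
    cardMoment 2 (N + 1) = cardMoment 2 N +
      X ^ (N + 1) * (cardMoment 2 (N + 1) + (cardMoment 1 (N + 1) + cardMoment 1 (N + 1) +
        cardMoment 0 (N + 1))) := by
  conv_lhs => rw [cardMoment, gf_le_succ]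
  simp only [cardMoment, ← gf_add]
  congr 3
  ext s
  push_cast [Multiset.card_cons]
  ring

/-- The signed generating function of the sets of parts in `(a, N]`. -/
noncomputable def signedDistinct (a N : ℕ) : ℤ⟦X⟧ :=
  gf (fun s => (∀ i ∈ s, i ≤ N) ∧ s.Nodup ∧ ∀ i ∈ s, a < i) (fun s => (-1) ^ s.card)

theorem signedDistinct_self (a : ℕ) : signedDistinct a a = 1 := by
  rw [signedDistinct, gf_empty]
  · simp
  · refine fun s _ => ⟨fun h => ?_, fun h => by simp [h]⟩
    refine Multiset.eq_zero_of_forall_notMem fun i hi => ?_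
    have := h.1 i hi
    have := h.2.2 i hi
    omega

theorem signedDistinct_succ {a N : ℕ} (h : a ≤ N) :
    signedDistinct a (N + 1) = (1 - X ^ (N + 1)) * signedDistinct a N := by
  -- Splitting off `N + 1` flips the sign, and distinctness keeps `N + 1` out of the rest.
  have h1 : gf (fun s => (∀ i ∈ s, i ≤ N + 1) ∧ ((N + 1) ::ₘ s).Nodup ∧
      ∀ i ∈ (N + 1) ::ₘ s, a < i) (fun s => (-1 : ℤ) ^ ((N + 1) ::ₘ s).card) =
      -signedDistinct a N := by
    rw [signedDistinct, ← gf_neg]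
    refine gf_congr (fun s _ => ?_) fun s _ _ => by rw [Multiset.card_cons]; ring
    simp only [Multiset.nodup_cons, Multiset.mem_cons, forall_eq_or_imp]
    constructor
    · rintro ⟨h3, ⟨h4, h5⟩, -, h6⟩
      refine ⟨fun i hi => ?_, h5, h6⟩
      have := h3 i hi
      have : i ≠ N + 1 := fun hh => h4 (hh ▸ hi)
      omega
    · rintro ⟨h3, h4, h5⟩
      refine ⟨fun i hi => (h3 i hi).trans N.le_succ, ⟨fun hi => ?_, h4⟩, by omega, h5⟩
      have := h3 _ hi
      omega
  rw [signedDistinct, gf_le_and_succ N (fun s => s.Nodup ∧ ∀ i ∈ s, a < i), h1, ← signedDistinct]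
  ring

/-- The number of appearances of the smallest element of a multiset. -/
def smallestCount (s : Multiset ℕ) : ℕ := (s.filter (fun i => ∀ j ∈ s, i ≤ j)).card

/-- The generating function of `spt(n, N)`. -/
noncomputable def sptSeries (N : ℕ) : ℤ⟦X⟧ :=
  gf (fun s => ∀ i ∈ s, i ≤ N) (fun s => (smallestCount s : ℤ))

/-- A part below `M` keeps the new `M` from being smallest. Otherwise all parts equal `M` and each
of them counts, including the case of empty `s`. -/
theorem smallestCount_cons {M : ℕ} {s : Multiset ℕ} (hs : ∀ i ∈ s, i ≤ M)
    [Decidable (∀ i ∈ s, i = M)] :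
    smallestCount (M ::ₘ s) = smallestCount s + if ∀ i ∈ s, i = M then 1 else 0 := by
  unfold smallestCount
  split_ifs with h
  · rw [Multiset.filter_eq_self.2, Multiset.filter_eq_self.2, Multiset.card_cons]
    · intro a ha b hb
      rw [h a ha, h b hb]
    · have h' : ∀ i ∈ M ::ₘ s, i = M := by simpa using h
      intro a ha b hb
      rw [h' a ha, h' b hb]
  · push Not at h
    obtain ⟨x, hx, hxM⟩ := h
    have hlt : x < M := lt_of_le_of_ne (hs x hx) hxM
    rw [Multiset.filter_cons_of_neg, add_zero]
    · congr 1
      refine Multiset.filter_congr fun i hi => ?_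
      simp [hs i hi]
    · intro h
      have := h x (Multiset.mem_cons_of_mem hx)
      omega

theorem sptSeries_zero : sptSeries 0 = 0 := by
  rw [sptSeries, gf_le_zero]
  simp [smallestCount]

/-- The generating function of the partitions all of whose parts are `N + 1`. -/
noncomputable def constSeries (N : ℕ) : ℤ⟦X⟧ :=
  gf (fun s => (∀ i ∈ s, i ≤ N + 1) ∧ ∀ i ∈ s, i = N + 1) (fun _ => 1)

theorem constSeries_eq (N : ℕ) : constSeries N = 1 + X ^ (N + 1) * constSeries N := by
  conv_lhs => rw [constSeries, gf_le_and_succ N (fun s => ∀ i ∈ s, i = N + 1)]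
  congr 1
  · rw [gf_empty]
    · simp
    · refine fun s _ => ⟨fun h => ?_, fun h => by simp [h]⟩
      refine Multiset.eq_zero_of_forall_notMem fun i hi => ?_
      have := h.1 i hi
      have := h.2 i hi
      omega
  · rw [constSeries]
    congr 1
    exact gf_congr (fun s _ => by simp) fun _ _ _ => rfl

theorem sptSeries_succ (N : ℕ) :
    sptSeries (N + 1) = sptSeries N + X ^ (N + 1) * (sptSeries (N + 1) + constSeries N) := by
  classical
  conv_lhs => rw [sptSeries, gf_le_succ N]
  rw [sptSeries, sptSeries, constSeries,
    ← gf_ite (fun s => ∀ i ∈ s, i ≤ N + 1) (fun s => ∀ i ∈ s, i = N + 1) (fun _ => 1), ← gf_add]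
  congr 2
  refine gf_congr (fun _ _ => Iff.rfl) fun s _ hs => ?_
  rw [smallestCount_cons hs]
  push_cast
  rfl

/-! ### Durfee squares and the rank -/

/-- The Durfee square of `s` has size `j`. -/
def IsDurfee (j : ℕ) (s : Multiset ℕ) : Prop :=
  j ≤ (s.filter (j ≤ ·)).card ∧ (s.filter (j < ·)).card ≤ j

theorem durfeeSize_eq_iff {n : ℕ} (π : n.Partition) {j : ℕ} (hj : 0 < j) :
    durfeeSize π = j ↔ IsDurfee j π.parts := by
  rw [durfeeSize, Nat.findGreatest_eq_iff, IsDurfee]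
  constructor
  · rintro ⟨h1, h2, h3⟩
    refine ⟨h2 hj.ne', ?_⟩
    by_contra! h
    -- Keeps the competitor `j + 1` within the search bound of `Nat.findGreatest`.
    have h4 : (π.parts.filter (j < ·)).card ≤ n :=
      (Multiset.card_le_card (Multiset.filter_le _ _)).trans (numParts_le π)
    exact h3 (Nat.lt_succ_self j) (by omega) h
  · rintro ⟨h1, h2⟩
    refine ⟨h1.trans ((Multiset.card_le_card (Multiset.filter_le _ _)).trans (numParts_le π)),
      fun _ => h1, fun k hk _ h => ?_⟩
    have h4 : (π.parts.filter (k ≤ ·)).card ≤ (π.parts.filter (j < ·)).card :=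
      Multiset.card_le_card (Multiset.monotone_filter_right _ fun i hi => lt_of_lt_of_le hk hi)
    omega

theorem filter_le_card (j : ℕ) (s : Multiset ℕ) :
    (s.filter (j ≤ ·)).card = (s.filter (j < ·)).card + s.count j := by
  induction s using Multiset.induction_on with
  | empty => simp
  | cons a s ih =>
    simp only [Multiset.filter_cons, Multiset.count_cons, Multiset.card_add, ih]
    rcases lt_trichotomy j a with h | h | h
    · simp [h, h.le, h.ne]
      omega
    · simp [h]
      omega
    · simp [h.not_ge, h.not_gt, h.ne']

/-- The Durfee square decomposition: the partitions with Durfee square of size `j` correspond to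
the pairs of a partition with parts at most `j` and a partition into at most `j` parts. -/
theorem gf_isDurfee (j : ℕ) (W : Multiset ℕ → ℤ) :
    gf (IsDurfee j) W = X ^ (j ^ 2) * gfPair (fun s => ∀ i ∈ s, i ≤ j) (fun s => s.card ≤ j)
      (fun a b => W (b.map (· + j) + Multiset.replicate (j - b.card) j + a)) := by
  have hf : ∀ a b : Multiset ℕ, 0 ∉ b → (∀ i ∈ a, i ≤ j) →
      (b.map (· + j) + Multiset.replicate (j - b.card) j + a).filter (j < ·) = b.map (· + j) := by
    intro a b hb ha
    rw [Multiset.filter_add, Multiset.filter_add, Multiset.filter_eq_self.2,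
      Multiset.filter_eq_nil.2, Multiset.filter_eq_nil.2, add_zero, add_zero]
    · intro i hi
      exact not_lt.2 (ha i hi)
    · intro i hi
      rw [Multiset.eq_of_mem_replicate hi]
      exact lt_irrefl j
    · intro i hi
      obtain ⟨x, hx, rfl⟩ := Multiset.mem_map.1 hi
      have : x ≠ 0 := fun h => hb (h ▸ hx)
      omega
  have hf' : ∀ a b : Multiset ℕ, 0 ∉ b → (∀ i ∈ a, i ≤ j) →
      (b.map (· + j) + Multiset.replicate (j - b.card) j + a).filter (fun i => ¬ j < i) =
        Multiset.replicate (j - b.card) j + a := by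
    intro a b hb ha
    rw [Multiset.filter_add, Multiset.filter_add, Multiset.filter_eq_nil.2,
      Multiset.filter_eq_self.2, Multiset.filter_eq_self.2, zero_add]
    · intro i hi
      exact not_lt.2 (ha i hi)
    · intro i hi
      rw [Multiset.eq_of_mem_replicate hi]
      exact lt_irrefl j
    · intro i hi
      obtain ⟨x, hx, rfl⟩ := Multiset.mem_map.1 hi
      have : x ≠ 0 := fun h => hb (h ▸ hx)
      omega
  -- Parts above `j` lose `j` and form `b`. They fill only some rows of the square; the other rows
  -- are parts equal to `j`, which are removed from the small parts to leave `a`.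
  refine gf_eq_X_pow_mul_gfPair (j ^ 2) _ _ _ W
    (fun a b => b.map (· + j) + Multiset.replicate (j - b.card) j + a)
    (fun s => s.filter (fun i => ¬ j < i) - Multiset.replicate (j - (s.filter (j < ·)).card) j)
    (fun s => (s.filter (j < ·)).map (· - j)) ?_ ?_
  · intro a b ha0 hb0 ha hb
    refine ⟨?_, ⟨?_, ?_⟩, ?_, ?_, ?_⟩
    · simp only [Multiset.mem_add, Multiset.mem_map, Multiset.mem_replicate, not_or, ha0,
        not_false_eq_true, and_true, not_exists, not_and]
      refine ⟨fun x hx => ?_, fun h => by omega⟩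
      have : x ≠ 0 := fun h => hb0 (h ▸ hx)
      omega
    · rw [filter_le_card, hf a b hb0 ha]
      simp only [Multiset.card_map, Multiset.count_add, Multiset.count_replicate_self]
      omega
    · rw [hf a b hb0 ha, Multiset.card_map]
      exact hb
    · obtain ⟨c, rfl⟩ := Nat.exists_eq_add_of_le hb
      simp only [Multiset.sum_add, Multiset.sum_map_add, Multiset.sum_replicate, Multiset.map_id',
        Multiset.map_const', smul_eq_mul, Nat.add_sub_cancel_left]
      ring
    · simp only [hf a b hb0 ha, hf' a b hb0 ha, Multiset.card_map]
      exact add_tsub_cancel_left _ _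
    · simp only [hf a b hb0 ha, Multiset.map_map]
      simp
  · rintro s h0 ⟨h1, h2⟩
    rw [filter_le_card] at h1
    have hle : Multiset.replicate (j - (s.filter (j < ·)).card) j ≤ s.filter (fun i => ¬ j < i) := by
      rw [← Multiset.le_count_iff_replicate_le, Multiset.count_filter_of_pos (p := fun i => ¬ j < i) (lt_irrefl j)]
      omega
    refine ⟨?_, ?_, ?_, ?_, ?_⟩
    · exact fun h => h0 (Multiset.mem_of_mem_filter (Multiset.mem_of_le (Multiset.sub_le_self _ _) h))
    · simp only [Multiset.mem_map, Multiset.mem_filter, not_exists, not_and]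
      intro a ha
      omega
    · intro i hi
      exact not_lt.1 (Multiset.mem_filter.1 (Multiset.mem_of_le (Multiset.sub_le_self _ _) hi)).2
    · simpa using h2
    · have h3 : ((s.filter (j < ·)).map (· - j)).map (· + j) = s.filter (j < ·) := by
        rw [Multiset.map_map]
        conv_rhs => rw [← Multiset.map_id (s.filter (j < ·))]
        refine Multiset.map_congr rfl fun a ha => ?_
        have := (Multiset.mem_filter.1 ha).2
        simp only [Function.comp, id]
        omega
      simp only [h3, Multiset.card_map]
      rw [add_assoc, add_tsub_cancel_of_le hle, Multiset.filter_add_not (j < ·)]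

/-- The second moment of the difference of the numbers of parts over pairs of partitions with
parts at most `N`. -/
noncomputable def diffMoment (N : ℕ) : ℤ⟦X⟧ :=
  2 * (cardMoment 2 N * cardMoment 0 N - cardMoment 1 N ^ 2)

theorem gfPair_card_sub_card (N : ℕ) :
    gfPair (fun s => ∀ i ∈ s, i ≤ N) (fun s => ∀ i ∈ s, i ≤ N)
      (fun s t => ((s.card : ℤ) - (t.card : ℤ)) ^ 2) = diffMoment N := by
  rw [gfPair_sub_sq, diffMoment]
  simp only [cardMoment, pow_zero, pow_one]
  ring

/-- The side `j` of the square enters both the largest part and the number of parts, so it cancels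
in the rank. -/
theorem gf_isDurfee_rank_sq {j : ℕ} (hj : 0 < j) :
    gf (IsDurfee j) (fun s => ((s.sup : ℤ) - (s.card : ℤ)) ^ 2) =
      X ^ (j ^ 2) * diffMoment j := by
  rw [gf_isDurfee]
  congr 1
  have h : gfPair (fun s => ∀ i ∈ s, i ≤ j) (fun s => s.card ≤ j)
      (fun a b => ((((b.map (· + j) + Multiset.replicate (j - b.card) j + a).sup : ℕ) : ℤ) -
        ((b.map (· + j) + Multiset.replicate (j - b.card) j + a).card : ℤ)) ^ 2) =
      gfPair (fun s => ∀ i ∈ s, i ≤ j) (fun s => s.card ≤ j)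
        (fun a b => ((a.card : ℤ) - (b.sup : ℤ)) ^ 2) := by
    refine gfPair_congr fun a b ha' hb' => ?_
    rw [sup_map_add a b j j hj hb' ha']
    have hcard : (b.map (· + j) + Multiset.replicate (j - b.card) j + a).card = j + a.card := by
      simp only [Multiset.card_add, Multiset.card_map, Multiset.card_replicate]
      omega
    rw [hcard]
    push_cast
    ring
  rw [h, gfPair_sub_sq, diffMoment]
  have h0 := gf_card_le_sup j (fun _ => 1)
  have h1 := gf_card_le_sup j (fun c => (c : ℤ))
  have h2 := gf_card_le_sup j (fun c => (c : ℤ) ^ 2)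
  rw [h0, h1, h2]
  simp only [cardMoment, pow_zero, pow_one]
  ring

/-! ### The q-series identities over a field -/

section QSeries

variable {K : Type*} [Field K] (q : K)

/-- The `q`-Pochhammer symbol `(q; q)_N`. -/
def poch (N : ℕ) : K := ∏ i ∈ Finset.range N, (1 - q ^ (i + 1))

/-- The sum of `q ^ i / (1 - q ^ i) ^ 2` over `1 ≤ i ≤ N`. -/
def lambert (N : ℕ) : K := ∑ i ∈ Finset.range N, q ^ (i + 1) / (1 - q ^ (i + 1)) ^ 2

/-- The summand of Durfee's identity, normalized to have sum `1` over `0 ≤ j ≤ N`. -/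
def durfeeWeight (N j : ℕ) : K :=
  if j ≤ N then poch q N ^ 2 * q ^ (j ^ 2) / (poch q (N - j) * poch q j ^ 2) else 0

/-- The Wilf–Zeilberger companion of `durfeeWeight`. -/
def durfeeCompanion (N j : ℕ) : K :=
  -(q ^ (N - j) * (1 - q ^ j) ^ 2 / (1 - q ^ N) ^ 2 * durfeeWeight q N j)

theorem poch_succ (N : ℕ) : poch q (N + 1) = poch q N * (1 - q ^ (N + 1)) :=
  Finset.prod_range_succ _ _

theorem poch_zero : poch q 0 = 1 := Finset.prod_range_zero _

theorem lambert_succ (N : ℕ) :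
    lambert q (N + 1) = lambert q N + q ^ (N + 1) / (1 - q ^ (N + 1)) ^ 2 :=
  Finset.sum_range_succ _ _

theorem lambert_zero : lambert q 0 = 0 := Finset.sum_range_zero _

theorem durfeeWeight_of_lt {N j : ℕ} (h : N < j) : durfeeWeight q N j = 0 :=
  if_neg (not_le.2 h)

theorem durfeeCompanion_of_lt {N j : ℕ} (h : N < j) : durfeeCompanion q N j = 0 := by
  simp [durfeeCompanion, durfeeWeight_of_lt q h]

theorem durfeeCompanion_zero (N : ℕ) : durfeeCompanion q N 0 = 0 := by
  simp [durfeeCompanion]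

variable {q}

theorem poch_ne_zero (hq : ∀ i, 1 - q ^ (i + 1) ≠ 0) (N : ℕ) : poch q N ≠ 0 :=
  Finset.prod_ne_zero_iff.2 fun i _ => hq i

theorem durfeeWeight_zero (hq : ∀ i, 1 - q ^ (i + 1) ≠ 0) (N : ℕ) :
    durfeeWeight q N 0 = poch q N := by
  have := poch_ne_zero hq N
  simp only [durfeeWeight, poch_zero, Nat.zero_le, if_true, Nat.sub_zero]
  field_simp
  simp

/-- The Wilf–Zeilberger equation: the change in `N` is a difference in `j`, so sums over `j`
telescope. At `j = M + 1` only the boundary terms survive. -/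
theorem durfeeWeight_sub (hq : ∀ i, 1 - q ^ (i + 1) ≠ 0) {M j : ℕ} (hj : j ≤ M + 1) :
    durfeeWeight q (M + 1) j - durfeeWeight q M j =
      durfeeCompanion q (M + 1) (j + 1) - durfeeCompanion q (M + 1) j := by
  rcases Nat.lt_or_ge M j with h | h
  · obtain rfl : j = M + 1 := by omega
    rw [durfeeWeight_of_lt q h, durfeeCompanion_of_lt q (Nat.lt_succ_self _), durfeeCompanion]
    have := hq M
    rw [Nat.sub_self, pow_zero, one_mul, div_self (pow_ne_zero 2 this)]
    ring
  · obtain ⟨d, rfl⟩ := Nat.exists_eq_add_of_le h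
    have e1 : j + d + 1 - j = d + 1 := by omega
    have e2 : j + d + 1 - (j + 1) = d := by omega
    have e3 : j + d - j = d := by omega
    rw [durfeeCompanion, durfeeCompanion, durfeeWeight, durfeeWeight, durfeeWeight, if_pos hj,
      if_pos h, if_pos (by omega), e1, e2, e3, poch_succ, poch_succ, poch_succ]
    have h1 := poch_ne_zero hq (j + d)
    have h2 := poch_ne_zero hq j
    have h3 := poch_ne_zero hq d
    have h4 := hq (j + d)
    have h5 := hq j
    have h6 := hq d
    have p1 : q ^ (j + d + 1) = q ^ j * q ^ d * q := by ring
    have p2 : q ^ ((j + 1) ^ 2) = q ^ (j ^ 2) * (q ^ j) ^ 2 * q := by ring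
    rw [p1] at h4
    rw [pow_succ] at h5 h6
    rw [p1, p2, pow_succ q j, pow_succ q d]
    -- With these powers as independent unknowns, the claim is an identity of rational functions.
    generalize q ^ j = x at *
    generalize q ^ d = y at *
    generalize q ^ (j ^ 2) = z at *
    field_simp
    ring

theorem sum_durfeeWeight (hq : ∀ i, 1 - q ^ (i + 1) ≠ 0) (N : ℕ) :
    ∑ j ∈ Finset.range (N + 1), durfeeWeight q N j = 1 := by
  induction N with
  | zero => simp [durfeeWeight, poch_zero]
  | succ M ih =>
    have h := Finset.sum_congr rfl fun j (hj : j ∈ Finset.range (M + 1 + 1)) =>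
      durfeeWeight_sub hq (Nat.lt_succ_iff.1 (Finset.mem_range.1 hj))
    rw [Finset.sum_range_sub, durfeeCompanion_zero, durfeeCompanion_of_lt q (Nat.lt_succ_self _),
      Finset.sum_sub_distrib, Finset.sum_range_succ (durfeeWeight q M), ih,
      durfeeWeight_of_lt q (Nat.lt_succ_self _)] at h
    linear_combination h

/-- The numerator of the companion cancels the Lambert denominator, leaving a weight times a factor
free of `j`. This makes summation by parts against `lambert` work. -/
theorem durfeeCompanion_mul (hq : ∀ i, 1 - q ^ (i + 1) ≠ 0) (M j : ℕ) :
    durfeeCompanion q (M + 1) (j + 1) * (q ^ (j + 1) / (1 - q ^ (j + 1)) ^ 2) =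
      -(q ^ (M + 1) / (1 - q ^ (M + 1)) ^ 2 * durfeeWeight q (M + 1) (j + 1)) := by
  rcases Nat.lt_or_ge M j with h | h
  · rw [durfeeCompanion_of_lt q (by omega), durfeeWeight_of_lt q (by omega)]
    ring
  · obtain ⟨d, rfl⟩ := Nat.exists_eq_add_of_le h
    have e2 : j + d + 1 - (j + 1) = d := by omega
    rw [durfeeCompanion, e2]
    generalize durfeeWeight q (j + d + 1) (j + 1) = w
    have h4 := hq (j + d)
    have h5 := hq j
    field_simp
    ring

/-- Summation by parts moves the difference in `j` from the companion to `lambert`. The resulting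
weights lack only the term `j = 0`, which is `poch q (M + 1)`, from the total `1`. -/
theorem sum_durfeeWeight_lambert_succ (hq : ∀ i, 1 - q ^ (i + 1) ≠ 0) (M : ℕ) :
    ∑ j ∈ Finset.range (M + 1 + 1), durfeeWeight q (M + 1) j * lambert q j =
      ∑ j ∈ Finset.range (M + 1), durfeeWeight q M j * lambert q j +
        q ^ (M + 1) / (1 - q ^ (M + 1)) ^ 2 * (1 - poch q (M + 1)) := by
  have h0 : ∑ j ∈ Finset.range (M + 1), durfeeWeight q M j * lambert q j =
      ∑ j ∈ Finset.range (M + 1 + 1), durfeeWeight q M j * lambert q j := by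
    rw [Finset.sum_range_succ _ (M + 1), durfeeWeight_of_lt q (Nat.lt_succ_self _)]
    ring
  have h1 : ∑ j ∈ Finset.range (M + 1 + 1), durfeeWeight q (M + 1) (j + 1) =
      1 - poch q (M + 1) := by
    have h := Finset.sum_range_succ' (durfeeWeight q (M + 1)) (M + 1 + 1)
    rw [Finset.sum_range_succ, sum_durfeeWeight hq, durfeeWeight_zero hq,
      durfeeWeight_of_lt q (Nat.lt_succ_self _)] at h
    linear_combination -h
  rw [h0, ← h1, Finset.mul_sum, ← sub_eq_iff_eq_add', ← Finset.sum_sub_distrib]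
  have h2 := Finset.sum_range_sub (fun j => durfeeCompanion q (M + 1) j * lambert q j) (M + 1 + 1)
  rw [durfeeCompanion_zero, durfeeCompanion_of_lt q (Nat.lt_succ_self _)] at h2
  rw [← sub_eq_zero, ← Finset.sum_sub_distrib]
  -- The companion vanishes at both ends, so zero is a telescoping sum that can be compared
  -- termwise.
  have h3 : (0 : K) * lambert q (M + 1 + 1) - 0 * lambert q 0 = 0 := by ring
  rw [← h3, ← h2]
  refine Finset.sum_congr rfl fun j hj => ?_
  have h4 := durfeeWeight_sub hq (Nat.lt_succ_iff.1 (Finset.mem_range.1 hj))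
  have h5 := durfeeCompanion_mul hq M j
  rw [lambert_succ]
  linear_combination lambert q j * h4 - h5

/-- Here `hA` is the recurrence of the spt series. Both sides grow by `poch q (N + 1) * q ^ (N + 1)
/ (1 - q ^ (N + 1)) ^ 2`. -/
theorem poch_mul_eq_lambert_sub (hq : ∀ i, 1 - q ^ (i + 1) ≠ 0) (A : ℕ → K) (h0 : A 0 = 0)
    (hA : ∀ N, (1 - q ^ (N + 1)) * A (N + 1) = A N + q ^ (N + 1) / (1 - q ^ (N + 1))) (N : ℕ) :
    poch q N * A N =
      lambert q N - ∑ j ∈ Finset.range (N + 1), durfeeWeight q N j * lambert q j := by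
  induction N with
  | zero => simp [h0, lambert_zero]
  | succ M ih =>
    rw [sum_durfeeWeight_lambert_succ hq, lambert_succ]
    rw [poch_succ, mul_assoc, hA, mul_add, ih]
    have := hq M
    field_simp
    ring

/-- `C * A - B ^ 2` is `A ^ 2` times a variance. Each step adds an independent geometric variable of
variance `q ^ (N + 1) / (1 - q ^ (N + 1)) ^ 2`. -/
theorem moments_eq (hq : ∀ i, 1 - q ^ (i + 1) ≠ 0) (A B C : ℕ → K) (hA0 : A 0 = 1) (hB0 : B 0 = 0)
    (hC0 : C 0 = 0) (hA : ∀ N, A (N + 1) = A N + q ^ (N + 1) * A (N + 1))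
    (hB : ∀ N, B (N + 1) = B N + q ^ (N + 1) * (B (N + 1) + A (N + 1)))
    (hC : ∀ N, C (N + 1) = C N +
      q ^ (N + 1) * (C (N + 1) + (B (N + 1) + B (N + 1) + A (N + 1)))) (N : ℕ) :
    A N = (poch q N)⁻¹ ∧ C N * A N - B N ^ 2 = lambert q N / poch q N ^ 2 := by
  induction N with
  | zero => simp [hA0, hB0, hC0, lambert_zero, poch_zero]
  | succ M ih =>
    obtain ⟨ih1, ih2⟩ := ih
    have h1 := hq M
    have h2 := poch_ne_zero hq M
    have hA' : A (M + 1) = (poch q (M + 1))⁻¹ := by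
      rw [poch_succ, ← mul_eq_one_iff_eq_inv₀ (mul_ne_zero h2 h1)]
      have : A M * poch q M = 1 := by rw [ih1, inv_mul_cancel₀ h2]
      linear_combination poch q M * hA M + this
    refine ⟨hA', ?_⟩
    have key : (C (M + 1) * A (M + 1) - B (M + 1) ^ 2) * (1 - q ^ (M + 1)) ^ 2 =
        (C M * A M - B M ^ 2) + q ^ (M + 1) * A (M + 1) ^ 2 := by
      have eA : A M = A (M + 1) - q ^ (M + 1) * A (M + 1) := by linear_combination -hA M
      have eB : B M = B (M + 1) - q ^ (M + 1) * (B (M + 1) + A (M + 1)) := by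
        linear_combination -hB M
      have eC : C M = C (M + 1) -
          q ^ (M + 1) * (C (M + 1) + (B (M + 1) + B (M + 1) + A (M + 1))) := by
        linear_combination -hC M
      rw [eA, eB, eC]
      ring
    rw [ih2, hA', ← eq_div_iff (pow_ne_zero 2 h1)] at key
    rw [hA', key, lambert_succ, poch_succ]
    field_simp

end QSeries

/-! ### The series of σ as a Lambert series -/

/-- The generating function of `σ(n, N)`. -/
noncomputable def sigmaSeries (N : ℕ) : ℤ⟦X⟧ := PowerSeries.mk fun n => (sigma n N : ℤ)

/-- The Lambert series of `X ^ M / (1 - X ^ M) ^ 2`. -/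
noncomputable def lambertTerm (M : ℕ) : ℤ⟦X⟧ :=
  PowerSeries.mk fun n => if M ∣ n then ((n / M : ℕ) : ℤ) else 0

theorem mul_mk_dvd {M : ℕ} (hM : 0 < M) :
    (1 - X ^ M) * (PowerSeries.mk fun n => if M ∣ n then (1 : ℤ) else 0) = 1 := by
  ext n
  rw [sub_mul, one_mul, map_sub, coeff_X_pow_mul', coeff_mk, coeff_mk, coeff_one]
  rcases Nat.lt_or_ge n M with h | h
  · rw [if_neg h.not_ge]
    rcases Nat.eq_zero_or_pos n with rfl | hn
    · simp
    · rw [if_neg (Nat.not_dvd_of_pos_of_lt hn h), if_neg hn.ne']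
      rfl
  · obtain ⟨d, rfl⟩ := Nat.exists_eq_add_of_le h
    rw [if_pos h, if_neg (c := M + d = 0) (by omega), Nat.add_sub_cancel_left]
    simp only [Nat.dvd_add_right (dvd_refl M), sub_self]

theorem mul_lambertTerm {M : ℕ} (hM : 0 < M) : (1 - X ^ M) ^ 2 * lambertTerm M = X ^ M := by
  have h : (1 - X ^ M) * lambertTerm M =
      X ^ M * (PowerSeries.mk fun n => if M ∣ n then (1 : ℤ) else 0) := by
    ext n
    rw [sub_mul, one_mul, map_sub, coeff_X_pow_mul', coeff_X_pow_mul', lambertTerm, coeff_mk,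
      coeff_mk, coeff_mk]
    rcases Nat.lt_or_ge n M with h | h
    · rw [if_neg h.not_ge, if_neg h.not_ge, Nat.div_eq_of_lt h]
      simp
    · obtain ⟨d, rfl⟩ := Nat.exists_eq_add_of_le h
      rw [if_pos h, if_pos h, Nat.add_sub_cancel_left, Nat.add_div_left _ hM]
      simp only [Nat.dvd_add_right (dvd_refl M)]
      split_ifs <;> simp
  rw [pow_two, mul_assoc, h, mul_left_comm, mul_mk_dvd hM, mul_one]

theorem sigmaSeries_zero : sigmaSeries 0 = 0 := by
  ext n
  rw [sigmaSeries, coeff_mk, map_zero, sigma, Finset.sum_eq_zero]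
  · rfl
  · intro d hd
    rw [Finset.mem_filter, Nat.mem_divisors] at hd
    omega

theorem sigmaSeries_succ (N : ℕ) : sigmaSeries (N + 1) = sigmaSeries N + lambertTerm (N + 1) := by
  ext n
  rw [map_add, sigmaSeries, sigmaSeries, lambertTerm, coeff_mk, coeff_mk, coeff_mk, sigma, sigma]
  have h1 : (n.divisors.filter (fun d => n ≤ d * (N + 1))) =
      (n.divisors.filter (fun d => n ≤ d * N)) ∪
        (n.divisors.filter (fun d => n = d * (N + 1))) := by
    ext d
    simp only [Finset.mem_union, Finset.mem_filter, Nat.mem_divisors, ← and_or_left]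
    refine and_congr_right ?_
    -- For `n = d * e` the bound on `d` says that the codivisor `e` is at most `N + 1`.
    rintro ⟨⟨e, rfl⟩, h0⟩
    have hd : 0 < d := Nat.pos_of_ne_zero fun h => h0 (by simp [h])
    rw [Nat.mul_le_mul_left_iff hd, Nat.mul_le_mul_left_iff hd, Nat.mul_right_inj hd.ne']
    omega
  have h2 : Disjoint (n.divisors.filter (fun d => n ≤ d * N))
      (n.divisors.filter (fun d => n = d * (N + 1))) := by
    rw [Finset.disjoint_filter]
    intro d hd hle heq
    have := Nat.pos_of_mem_divisors hd
    rw [mul_add] at heq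
    omega
  rw [h1, Finset.sum_union h2, Nat.cast_add]
  congr 1
  rcases Nat.eq_zero_or_pos n with rfl | hn
  · simp
  split_ifs with h
  · obtain ⟨e, rfl⟩ := h
    rw [Finset.sum_eq_single e, Nat.mul_div_cancel_left _ N.succ_pos]
    · intro d hd hne
      rw [Finset.mem_filter, mul_comm d, Nat.mul_right_inj N.succ_ne_zero] at hd
      exact absurd hd.2.symm hne
    · intro hd
      refine absurd ?_ hd
      rw [Finset.mem_filter, Nat.mem_divisors]
      exact ⟨⟨Dvd.intro_left _ rfl, hn.ne'⟩, mul_comm _ _⟩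
  · rw [Nat.cast_eq_zero]
    refine Finset.sum_eq_zero fun d hd => absurd ?_ h
    rw [Finset.mem_filter] at hd
    exact Dvd.intro_left d hd.2.symm

/-! ### Transfer to the fraction field of power series at q = X -/

theorem one_sub_X_pow_ne_zero (i : ℕ) :
    (1 : FractionRing ℤ⟦X⟧) - algebraMap ℤ⟦X⟧ (FractionRing ℤ⟦X⟧) X ^ (i + 1) ≠ 0 := by
  rw [← map_pow, ← map_one (algebraMap ℤ⟦X⟧ (FractionRing ℤ⟦X⟧)), ← map_sub]
  refine (map_ne_zero_iff _ (IsFractionRing.injective ℤ⟦X⟧ (FractionRing ℤ⟦X⟧))).2 fun h => ?_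
  have := congrArg constantCoeff h
  simp at this

local notation "φ" => algebraMap ℤ⟦X⟧ (FractionRing ℤ⟦X⟧)

theorem map_moments (N : ℕ) : φ (cardMoment 0 N) = (poch (φ X) N)⁻¹ ∧
    φ (diffMoment N) = 2 * (lambert (φ X) N / poch (φ X) N ^ 2) := by
  have h := moments_eq one_sub_X_pow_ne_zero (fun N => φ (cardMoment 0 N))
    (fun N => φ (cardMoment 1 N)) (fun N => φ (cardMoment 2 N))
    (by rw [cardMoment_zero_zero, map_one]) (by rw [cardMoment_zero one_ne_zero, map_zero])
    (by rw [cardMoment_zero two_ne_zero, map_zero])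
    (fun N => by simpa using congrArg φ (cardMoment_zero_succ N))
    (fun N => by simpa using congrArg φ (cardMoment_one_succ N))
    (fun N => by simpa using congrArg φ (cardMoment_two_succ N)) N
  refine ⟨h.1, ?_⟩
  rw [← h.2, diffMoment]
  simp only [map_mul, map_sub, map_pow, map_ofNat]

theorem map_signedDistinct (a d : ℕ) :
    φ (signedDistinct a (a + d)) = poch (φ X) (a + d) / poch (φ X) a := by
  have h := poch_ne_zero one_sub_X_pow_ne_zero a
  induction d with
  | zero => rw [add_zero, signedDistinct_self, map_one, div_self h]
  | succ d ih =>
    rw [← add_assoc, signedDistinct_succ (Nat.le_add_right a d), map_mul, ih, poch_succ]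
    simp only [map_sub, map_one, map_pow]
    ring

theorem poch_mul_map_sptSeries (N : ℕ) : poch (φ X) N * φ (sptSeries N) =
    lambert (φ X) N - ∑ j ∈ Finset.range (N + 1), durfeeWeight (φ X) N j * lambert (φ X) j := by
  refine poch_mul_eq_lambert_sub one_sub_X_pow_ne_zero (fun N => φ (sptSeries N))
    (by rw [sptSeries_zero, map_zero]) (fun N => ?_) N
  have h := one_sub_X_pow_ne_zero N
  have h1 := congrArg φ (sptSeries_succ N)
  have h2 := congrArg φ (constSeries_eq N)
  simp only [map_add, map_mul, map_pow, map_one] at h1 h2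
  have h3 : φ (constSeries N) = 1 / (1 - φ X ^ (N + 1)) := by
    rw [eq_div_iff h]
    linear_combination h2
  rw [h3] at h1
  linear_combination h1

theorem map_sigmaSeries (N : ℕ) : φ (sigmaSeries N) = lambert (φ X) N := by
  induction N with
  | zero => rw [sigmaSeries_zero, map_zero, lambert_zero]
  | succ N ih =>
    rw [sigmaSeries_succ, map_add, ih, lambert_succ]
    congr 1
    rw [eq_div_iff (pow_ne_zero 2 (one_sub_X_pow_ne_zero N))]
    have h := congrArg φ (mul_lambertTerm N.succ_pos)
    simp only [map_mul, map_pow, map_sub, map_one, Nat.succ_eq_add_one] at h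
    linear_combination h

/-- The generating function of the second crank moments. -/
theorem crankSeries_eq (N : ℕ) :
    signedDistinct 0 N * diffMoment N = 2 * (cardMoment 0 N * sigmaSeries N) := by
  apply IsFractionRing.injective ℤ⟦X⟧ (FractionRing ℤ⟦X⟧)
  have h1 := map_signedDistinct 0 N
  have h2 := poch_ne_zero one_sub_X_pow_ne_zero N
  rw [zero_add, poch_zero] at h1
  rw [map_mul, map_mul, map_mul, h1, (map_moments N).1, (map_moments N).2, map_sigmaSeries,
    map_ofNat]
  field_simp

/-- The generating function form of the theorem. -/
theorem two_mul_sptSeries (N : ℕ) : 2 * sptSeries N = 2 * (cardMoment 0 N * sigmaSeries N) -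
    ∑ j ∈ Finset.Icc 1 N, signedDistinct (N - j) N * (X ^ (j ^ 2) * diffMoment j) := by
  apply IsFractionRing.injective ℤ⟦X⟧ (FractionRing ℤ⟦X⟧)
  have h0 := poch_ne_zero one_sub_X_pow_ne_zero N
  have h1 := poch_mul_map_sptSeries N
  have h2 : poch (φ X) N * ∑ j ∈ Finset.Icc 1 N,
      φ (signedDistinct (N - j) N * (X ^ (j ^ 2) * diffMoment j)) =
      2 * ∑ j ∈ Finset.range (N + 1), durfeeWeight (φ X) N j * lambert (φ X) j := by
    -- The term `j = 0`, absent from the rank series, vanishes because `lambert` is zero there.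
    rw [Finset.sum_range_succ', lambert_zero, mul_zero, add_zero, Finset.range_eq_Ico,
      Finset.sum_Ico_add' (fun j => durfeeWeight (φ X) N j * lambert (φ X) j) 0 N 1, zero_add,
      Finset.mul_sum, Finset.mul_sum]
    refine Finset.sum_congr (by ext; simp) fun j hj => ?_
    obtain ⟨d, rfl⟩ := Nat.exists_eq_add_of_le (Finset.mem_Icc.1 hj).2
    have h3 := map_signedDistinct d j
    rw [add_comm d j] at h3
    rw [Nat.add_sub_cancel_left, map_mul, map_mul, map_pow, (map_moments j).2, h3, durfeeWeight,
      if_pos (Nat.le_add_right j d), Nat.add_sub_cancel_left]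
    have h4 := poch_ne_zero one_sub_X_pow_ne_zero d
    have h5 := poch_ne_zero one_sub_X_pow_ne_zero j
    field_simp
  apply mul_left_cancel₀ h0
  rw [map_sub, map_mul, map_mul, map_mul, map_ofNat, (map_moments N).1, map_sigmaSeries, map_sum,
    mul_sub, h2]
  rw [mul_left_comm, h1]
  field_simp

/-! ### Coefficients of the series as partition counts and moments -/

theorem largestPart_le_iff {n N : ℕ} (π : n.Partition) :
    largestPart π ≤ N ↔ ∀ i ∈ π.parts, i ≤ N :=
  Multiset.sup_le

theorem mem_partitionsLE {n N : ℕ} (π : n.Partition) :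
    π ∈ partitionsLE n N ↔ ∀ i ∈ π.parts, i ≤ N := by
  rw [partitionsLE, Finset.mem_filter, largestPart_le_iff]
  simp

theorem sum_partsFinset_le (n N : ℕ) (W : Multiset ℕ → ℤ)
    [DecidablePred fun s : Multiset ℕ => ∀ i ∈ s, i ≤ N] :
    ∑ s ∈ partsFinset n with ∀ i ∈ s, i ≤ N, W s = ∑ π ∈ partitionsLE n N, W π.parts := by
  rw [sum_partition (fun s => ∀ i ∈ s, i ≤ N) W (partitionsLE n N) mem_partitionsLE, coeff_gf]
  congr!

theorem coeff_sptSeries (n N : ℕ) : coeff n (sptSeries N) = (spt n N : ℤ) := by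
  rw [spt, sptSeries, ← sum_partition _ _ (partitionsLE n N) mem_partitionsLE]
  push_cast
  rfl

theorem coeff_cardMoment_zero (n N : ℕ) : coeff n (cardMoment 0 N) = (p n N : ℤ) := by
  rw [p, cardMoment, ← sum_partition _ _ (partitionsLE n N) mem_partitionsLE]
  simp

theorem coeff_cardMoment_mul_sigmaSeries (n N : ℕ) :
    coeff n (cardMoment 0 N * sigmaSeries N) =
      ∑ j ∈ Finset.range n, (p j N : ℤ) * (sigma (n - j) N : ℤ) := by
  -- The term `j = n` drops out: `0` has no divisors in `Nat.divisors`, so `sigma 0 N = 0`.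
  rw [coeff_mul, Finset.Nat.sum_antidiagonal_eq_sum_range_succ_mk, Finset.sum_range_succ]
  simp [coeff_cardMoment_zero, sigmaSeries, sigma]

theorem sum_Icc_sq_mul_ite {n : ℕ} {x : ℤ} (hx : |x| ≤ n) (c : ℤ) :
    ∑ m ∈ Finset.Icc (-n : ℤ) n, m ^ 2 * (if x = m then c else 0) = c * x ^ 2 := by
  rw [Finset.sum_eq_single x]
  · rw [if_pos rfl, mul_comm]
  · intro m _ hm
    rw [if_neg (Ne.symm hm), mul_zero]
  · intro h
    exact absurd (Finset.mem_Icc.2 (abs_le.1 hx)) h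

theorem finsum_eq_sum_Icc (n : ℕ) (f : ℤ → ℤ) (hf : ∀ m : ℤ, (n : ℤ) < |m| → f m = 0) :
    ∑ᶠ m : ℤ, m ^ 2 * f m = ∑ m ∈ Finset.Icc (-n : ℤ) n, m ^ 2 * f m := by
  refine finsum_eq_sum_of_support_subset _ fun m hm => ?_
  rw [Finset.coe_Icc, Set.mem_Icc, ← abs_le]
  by_contra! h
  exact hm (by simp [hf m h])

theorem signedDistinct_coeff (a N n : ℕ) (S : Finset n.Partition)
    (hS : ∀ π, π ∈ S ↔ (∀ i ∈ π.parts, i ≤ N) ∧ π.parts.Nodup ∧ ∀ i ∈ π.parts, a < i) :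
    ∑ π ∈ S, (-1) ^ numParts π = coeff n (signedDistinct a N) :=
  sum_partition _ (fun s => (-1) ^ s.card) S hS

theorem abs_rank_le {n : ℕ} (π : n.Partition) : |rank π| ≤ n := by
  have h1 := largestPart_le π
  have h2 := numParts_le π
  rw [rank, abs_le]
  omega

/-- Once the sum over `m` is finite it can be moved innermost, where only `m = rank π₂` survives and
leaves the weight `rank π₂ ^ 2`. -/
theorem rankMoment_two (N n : ℕ) : rankMoment 2 N n = ∑ j ∈ Finset.Icc 1 N,
    coeff n (signedDistinct (N - j) N * (X ^ (j ^ 2) * diffMoment j)) := by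
  rw [rankMoment, finsum_eq_sum_Icc n _ (rankCount_eq_zero N n)]
  simp only [rankCount, Finset.mul_sum]
  rw [Finset.sum_comm]
  refine Finset.sum_congr rfl fun j hj => ?_
  obtain ⟨hj1, hj2⟩ := Finset.mem_Icc.1 hj
  simp only [rankCountDurfee, Finset.mul_sum]
  rw [Finset.sum_comm, coeff_mul]
  refine Finset.sum_congr rfl fun a ha => ?_
  have ha' := Finset.HasAntidiagonal.mem_antidiagonal.1 ha
  rw [Finset.sum_comm, ← signedDistinct_coeff (N - j) N a.1, Finset.sum_mul]
  · refine Finset.sum_congr rfl fun π₁ _ => ?_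
    rw [← gf_isDurfee_rank_sq hj1, ← sum_partition _ _
      (Finset.univ.filter fun π : a.2.Partition => durfeeSize π = j)
      (fun π => by simp [durfeeSize_eq_iff π hj1]), Finset.mul_sum]
    have h1 : ∀ m : ℤ, ∑ π₂ : a.2.Partition with durfeeSize π₂ = j ∧ rank π₂ = m,
        m ^ 2 * (-1) ^ numParts π₁ = ∑ π₂ : a.2.Partition with durfeeSize π₂ = j,
          m ^ 2 * if rank π₂ = m then (-1) ^ numParts π₁ else 0 := by
      intro m
      rw [← Finset.filter_filter, Finset.sum_filter]
      simp only [mul_ite, mul_zero]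
    simp only [h1]
    rw [Finset.sum_comm]
    refine Finset.sum_congr rfl fun π₂ _ => ?_
    rw [sum_Icc_sq_mul_ite]
    · rfl
    · have := abs_rank_le π₂
      omega
  · intro π
    simp only [Finset.mem_filter, Nat.Partition.distincts, Finset.mem_univ, true_and]
    constructor
    · rintro ⟨h1, h2⟩
      exact ⟨fun i hi => (h2 i hi).2, h1, fun i hi => by have := (h2 i hi).1; omega⟩
    · rintro ⟨h1, h2, h3⟩
      exact ⟨h2, fun i hi => ⟨by have := h3 i hi; omega, h1 i hi⟩⟩

theorem crankMoment_two (N n : ℕ) :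
    crankMoment 2 N n = coeff n (signedDistinct 0 N * diffMoment N) := by
  rw [crankMoment, finsum_eq_sum_Icc n _ (crankCount_eq_zero N n)]
  simp only [crankCount, Finset.mul_sum]
  rw [Finset.sum_comm, coeff_mul]
  refine Finset.sum_congr rfl fun a ha => ?_
  have ha' := Finset.HasAntidiagonal.mem_antidiagonal.1 ha
  rw [← gfPair_card_sub_card, coeff_gfPair, Finset.mul_sum, Finset.sum_comm]
  refine Finset.sum_congr rfl fun b hb => ?_
  have hb' := Finset.HasAntidiagonal.mem_antidiagonal.1 hb
  rw [Finset.sum_comm, ← signedDistinct_coeff 0 N a.1, Finset.sum_mul]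
  · refine Finset.sum_congr rfl fun π₁ _ => ?_
    simp only [sum_partsFinset_le]
    rw [Finset.sum_comm, Finset.mul_sum]
    refine Finset.sum_congr rfl fun π₂ _ => ?_
    simp only [Finset.sum_filter, Finset.mul_sum]
    rw [Finset.sum_comm]
    refine Finset.sum_congr rfl fun π₃ _ => ?_
    have h5 := sum_Icc_sq_mul_ite (n := n) (x := (numParts π₂ : ℤ) - numParts π₃) (by
      have := numParts_le π₂
      have := numParts_le π₃
      rw [abs_le]
      omega) ((-1) ^ numParts π₁)
    simp only [mul_ite, mul_zero] at h5
    exact h5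
  · intro π
    simp only [Finset.mem_filter, Nat.Partition.distincts, Finset.mem_univ, true_and,
      largestPart_le_iff]
    exact ⟨fun h => ⟨h.2, h.1, fun i hi => π.parts_pos hi⟩, fun h => ⟨h.2.1, h.1⟩⟩

end FiniteSpt

/-! ### The theorem, by comparing coefficients -/

theorem mainTheorem1 (N : ℕ) (hN : 1 ≤ N) (n : ℕ) :
    (FiniteSpt.spt n N : ℚ) =
        1 / 2 * ((FiniteSpt.crankMoment 2 N n : ℚ) - (FiniteSpt.rankMoment 2 N n : ℚ)) ∧
      (FiniteSpt.spt n N : ℚ) =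
        ∑ j ∈ Finset.range n, (FiniteSpt.p j N : ℚ) * (FiniteSpt.sigma (n - j) N : ℚ) -
          1 / 2 * (FiniteSpt.rankMoment 2 N n : ℚ) := by
  have h2 : ∀ f : PowerSeries ℤ, PowerSeries.coeff n (2 * f) = 2 * PowerSeries.coeff n f :=
    fun f => by rw [two_mul, two_mul, map_add]
  have h := congrArg (PowerSeries.coeff n) (FiniteSpt.two_mul_sptSeries N)
  rw [map_sub, map_sum, ← FiniteSpt.rankMoment_two, h2, h2, FiniteSpt.coeff_sptSeries,
    FiniteSpt.coeff_cardMoment_mul_sigmaSeries] at h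
  have hc := FiniteSpt.crankMoment_two N n
  rw [FiniteSpt.crankSeries_eq, h2, FiniteSpt.coeff_cardMoment_mul_sigmaSeries] at hc
  have h' := congrArg (Int.cast : ℤ → ℚ) h
  have hc' := congrArg (Int.cast : ℤ → ℚ) hc
  push_cast at h' hc'
  constructor
  · linear_combination h' / 2 - hc' / 2
  · linear_combination h' / 2
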